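/- **Setting.** Let $\Omega$ be a finite set of questions. For $q\in\Omega$ let $p_q^+,p_q^-\ge 0$ with $p_q^++p_q^-\le 1$, and let $c_q^+,c_q^-\in[0,1]$. A customer is shown a sequence $Q$ of distinct questions and starts by reading the first one. After reading a question $q$ she answers it and reads the next question with probability $p_q^+c_q^+$, answers it and exits with probability $p_q^+(1-c_q^+)$, selects "prefer not to answer" and reads the next question with probability $p_q^-c_q^-$, selects "prefer not to answer" and exits with probability $p_q^-(1-c_q^-)$, and exits immediately with probability $1-p_q^+-p_q^-$. The process ends when she exits or no question remains. Let $g:2^\Omega\to\mathbb R$ be non-decreasing and submodular with $g(\emptyset)=0$, and put $$f(Q)=\sum_{\mathcal S\subseteq \mathcal Q}\Pr[\mathcal S\mid Q]\,g(\mathcal S),$$ where $\mathcal Q$ is the set of questions in $Q$ and $\Pr[\mathcal S\mid Q]$ is the probability that $\mathcal S$ is exactly the set of answered questions. Let $b\ge 1$ be an integer and let $Q^*$ maximize $f(Q)$ over all sequences $Q$ of at most $b$ distinct questions. **Relaxed problem.** Let $c_q=p_q^+c_q^++p_q^-c_q^-$. Let $\mathcal R(\mathcal S)$ be the random set that contains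 each $q\in\mathcal S$ independently with probability $p_q^+$, and let $v(q,\mathcal S)=\mathbb E[g(\mathcal R(\mathcal S\cup\{q\}))]$. For $\rho\in[0,1]$ and a fixed $q\in\Omega$, problem $\mathbf{P3}$ is to maximize $v(q,\mathcal S)$ over all $\mathcal S\subseteq\Omega\setminus\{q\}$ with $$-\sum_{l\in\mathcal S}\log c_l\le-\log\rho,\qquad |\mathcal S|<b,$$ where $-\log 0=+\infty$. For $\alpha\in\mathbb R$, a feasible $\mathcal S$ is an $\alpha$-approximate solution for $q$ if $v(q,\mathcal S)\ge\alpha\, v(q,\mathcal T)$ for every feasible $\mathcal T$. **Algorithm 2.** Let $\epsilon>0$. Start with $\mathcal S'=\emptyset$ and $q'=\emptyset$ (no question), with $v(\emptyset,\emptyset)=g(\emptyset)=0$. Go through the questions $q\in\Omega$ one by one, in any order; for each $q$ let $\mathcal S$ be any $(1-1/e-\epsilon)$-approximate solution of $\mathbf{P3}$ for $q$, and if $v(q,\mathcal S)>v(q',\mathcal S')$, set $\mathcal S'\leftarrow\mathcal S$ and $q'\leftarrow q$. Finally return $Q^{\mathrm{Alg2}}$, the elements of $\mathcal S'$ in an arbitrary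 order followed by $q'$ (the empty sequence if $q'=\emptyset$). **Theorem.** For every $\rho\in[0,1]$, Algorithm 2 has an output, and every possible output $Q^{\mathrm{Alg2}}$ is a sequence of at most $b$ distinct questions with $$f(Q^{\mathrm{Alg2}})\ \ge\ \rho(1-\rho)\Bigl(1-\frac1e-\epsilon\Bigr)f(Q^*).$$ In particular, for $\rho=1/2$, $$f(Q^{\mathrm{Alg2}})\ \ge\ \frac14\Bigl(1-\frac1e-\epsilon\Bigr)f(Q^*).$$ -/

import Mathlib

/-- The parameters of the cascade browse model with a "Prefer Not to Answer" (PNA) option on a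
set `Ω` of questions. After reading `q` the customer answers it with probability `pAns q`, selects
PNA with probability `pPna q`, and exits otherwise; after answering (resp. PNA) she reads the next
question with probability `cAns q` (resp. `cPna q`). -/
structure CascadeModel (Ω : Type*) where
  pAns : Ω → ℝ
  pPna : Ω → ℝ
  cAns : Ω → ℝ
  cPna : Ω → ℝ
  pAns_nonneg : ∀ q, 0 ≤ pAns q
  pPna_nonneg : ∀ q, 0 ≤ pPna q
  pAns_add_pPna_le_one : ∀ q, pAns q + pPna q ≤ 1
  cAns_nonneg : ∀ q, 0 ≤ cAns q
  cAns_le_one : ∀ q, cAns q ≤ 1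
  cPna_nonneg : ∀ q, 0 ≤ cPna q
  cPna_le_one : ∀ q, cPna q ≤ 1

/-- The five actions available to a customer who has just read a question. -/
inductive BrowseAction where
  | answerContinue
  | answerExit
  | pnaContinue
  | pnaExit
  | leave

/-- Submodularity (diminishing returns) of a set function. -/
def IsSubmodular {Ω : Type*} [DecidableEq Ω] (g : Finset Ω → ℝ) : Prop :=
  ∀ Y₁ Y₂ : Finset Ω, Y₁ ⊆ Y₂ → ∀ y, y ∉ Y₂ →
    g (insert y Y₂) - g Y₂ ≤ g (insert y Y₁) - g Y₁

namespace CascadeModel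

/-- The probability of each action after question `q` has been read. -/
def actionProb {Ω : Type*} (M : CascadeModel Ω) (q : Ω) : BrowseAction → ℝ
  | .answerContinue => M.pAns q * M.cAns q
  | .answerExit => M.pAns q * (1 - M.cAns q)
  | .pnaContinue => M.pPna q * M.cPna q
  | .pnaExit => M.pPna q * (1 - M.cPna q)
  | .leave => 1 - (M.pAns q + M.pPna q)

theorem actionProb_nonneg {Ω : Type*} (M : CascadeModel Ω) (q : Ω) (a : BrowseAction) :
    0 ≤ M.actionProb q a := by
  have h1 := M.pAns_nonneg q
  have h2 := M.pPna_nonneg q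
  have h3 := M.pAns_add_pPna_le_one q
  have h4 := M.cAns_nonneg q
  have h5 := M.cAns_le_one q
  have h6 := M.cPna_nonneg q
  have h7 := M.cPna_le_one q
  cases a
  · exact mul_nonneg h1 h4
  · exact mul_nonneg h1 (by linarith)
  · exact mul_nonneg h2 h6
  · exact mul_nonneg h2 (by linarith)
  · show 0 ≤ 1 - (M.pAns q + M.pPna q)
    linarith

/-- The finite set of all five actions. -/
def allActions : Finset BrowseAction :=
  ⟨{.answerContinue, .answerExit, .pnaContinue, .pnaExit, .leave}, by simp⟩

theorem sum_actionProb {Ω : Type*} (M : CascadeModel Ω) (q : Ω) :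
    ∑ a ∈ allActions, ENNReal.ofReal (M.actionProb q a) = 1 := by
  rw [← ENNReal.ofReal_sum_of_nonneg (fun a _ => M.actionProb_nonneg q a)]
  have h : ∑ a ∈ allActions, M.actionProb q a = 1 := by
    simp [allActions, Finset.sum, actionProb]
    ring
  rw [h, ENNReal.ofReal_one]

/-- The law of the action taken after reading `q`. -/
noncomputable def actionLaw {Ω : Type*} (M : CascadeModel Ω) (q : Ω) : PMF BrowseAction :=
  PMF.ofFinset (fun a => ENNReal.ofReal (M.actionProb q a)) allActions (M.sum_actionProb q)
    (fun a ha => absurd (by cases a <;> simp [allActions]) ha)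

/-- The law of the set of questions answered by a customer who starts reading the first question
of the given sequence and proceeds according to the cascade browse process. -/
noncomputable def answeredLaw {Ω : Type*} [DecidableEq Ω] (M : CascadeModel Ω) :
    List Ω → PMF (Finset Ω)
  | [] => PMF.pure ∅
  | q :: Q => (M.actionLaw q).bind fun a =>
      match a with
      | .answerContinue => (answeredLaw M Q).map (insert q)
      | .answerExit => PMF.pure {q}
      | .pnaContinue => answeredLaw M Q
      | .pnaExit => PMF.pure ∅
      | .leave => PMF.pure ∅

/-- The expected utility `f(Q) = ∑_{S ⊆ Q} Pr[S | Q] g(S)` of a sequence of questions. -/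
noncomputable def expectedUtility {Ω : Type*} [DecidableEq Ω] (M : CascadeModel Ω)
    (g : Finset Ω → ℝ) (Q : List Ω) : ℝ :=
  ∑ S ∈ Q.toFinset.powerset, (M.answeredLaw Q S).toReal * g S

/-- The aggregated continuation probability `c_q = p⁺_q c⁺_q + p⁻_q c⁻_q`. -/
def contProb {Ω : Type*} (M : CascadeModel Ω) (q : Ω) : ℝ :=
  M.pAns q * M.cAns q + M.pPna q * M.cPna q

/-- `E[g(R(S))]`, where the random set `R(S)` contains each `q ∈ S` independently with
probability `p⁺_q`. -/
noncomputable def expectedRandomUtility {Ω : Type*} [DecidableEq Ω] (M : CascadeModel Ω)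
    (g : Finset Ω → ℝ) (S : Finset Ω) : ℝ :=
  ∑ T ∈ S.powerset, ((∏ q ∈ T, M.pAns q) * ∏ q ∈ S \ T, (1 - M.pAns q)) * g T

/-- The objective `v(q, S) = E[g(R(S ∪ {q}))]` of the relaxed problem. The first argument is an
`Option`, with `none` for the initial value `q' = ∅` of the algorithm. -/
noncomputable def relaxedObjective {Ω : Type*} [DecidableEq Ω] (M : CascadeModel Ω)
    (g : Finset Ω → ℝ) (q : Option Ω) (S : Finset Ω) : ℝ :=
  M.expectedRandomUtility g (S ∪ q.toFinset)

/-- The constraints of the relaxed problem for a fixed last question `q`. Logarithms take values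
in the extended reals, so that `-log 0 = ∞`. -/
structure RelaxedFeasible {Ω : Type*} (M : CascadeModel Ω) (ρ : ℝ) (b : ℕ) (q : Ω)
    (S : Finset Ω) : Prop where
  reachability : -∑ l ∈ S, ENNReal.log (ENNReal.ofReal (M.contProb l)) ≤
    -ENNReal.log (ENNReal.ofReal ρ)
  card_lt : S.card < b
  notMem : q ∉ S

/-- `S` is an `α`-approximate solution of the relaxed problem for a fixed last question `q`. -/
def RelaxedApprox {Ω : Type*} [DecidableEq Ω] (M : CascadeModel Ω) (g : Finset Ω → ℝ)
    (ρ : ℝ) (b : ℕ) (α : ℝ) (q : Ω) (S : Finset Ω) : Prop :=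
  M.RelaxedFeasible ρ b q S ∧
    ∀ T, M.RelaxedFeasible ρ b q T →
      α * M.relaxedObjective g (some q) T ≤ M.relaxedObjective g (some q) S

/-- The `for` loop of the algorithm, as a function of the order in which the questions are
enumerated and of the sets `solve q` returned by the subroutine. The state is `(q', S')`. -/
noncomputable def algLoop {Ω : Type*} [DecidableEq Ω] (M : CascadeModel Ω) (g : Finset Ω → ℝ)
    (solve : Ω → Finset Ω) (order : List Ω) : Option Ω × Finset Ω :=
  order.foldl
    (fun st q =>
      if M.relaxedObjective g (some q) (solve q) > M.relaxedObjective g st.1 st.2 then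
        (some q, solve q)
      else st)
    (none, ∅)

/-- `Q` is a possible output of the algorithm with input `ρ`, `b` and a subroutine of approximation
ratio `α`: the questions are enumerated in some order, the subroutine returns some `α`-approximate
solution of the relaxed problem for every last question, and the final set `S'` is arranged in an
arbitrary order before `q'`. -/
def IsAlgOutput {Ω : Type*} [DecidableEq Ω] (M : CascadeModel Ω) (g : Finset Ω → ℝ)
    (ρ : ℝ) (b : ℕ) (α : ℝ) (Q : List Ω) : Prop :=
  ∃ (order : List Ω) (solve : Ω → Finset Ω) (L : List Ω),
    (order.Nodup ∧ ∀ q, q ∈ order) ∧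
    (∀ q, M.RelaxedApprox g ρ b α q (solve q)) ∧
    (L.Nodup ∧ L.toFinset = (M.algLoop g solve order).2) ∧
    Q = L ++ (M.algLoop g solve order).1.toList

/-- `Q` is a solution of the quiz design problem: a sequence of at most `b` distinct questions. -/
def IsSolution {Ω : Type*} (b : ℕ) (Q : List Ω) : Prop :=
  Q.Nodup ∧ Q.length ≤ b

/-- `Q` is an optimal solution of the quiz design problem. -/
def IsOptimalSolution {Ω : Type*} [DecidableEq Ω] (M : CascadeModel Ω) (g : Finset Ω → ℝ)
    (b : ℕ) (Q : List Ω) : Prop :=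
  IsSolution b Q ∧ ∀ Q', IsSolution b Q' → M.expectedUtility g Q' ≤ M.expectedUtility g Q

end CascadeModel

/-! ### Passing probabilities and recursive forms of the two objectives -/

namespace CascadeModel

variable {Ω : Type*}

/-! Cut an optimal sequence as `P ++ x :: R`, where `P` is passed with probability at least `ρ` and
`P ++ [x]` with probability at most `ρ`, unless `R` is empty (`exists_split`). By submodularity `R`
adds at most its own utility times the probability of passing `P ++ [x]`; being a solution itself,
it adds at most `ρ f(Q*)`. So `(1 - ρ) f(Q*) ≤ f(P ++ [x])`, and monotonicity bounds the latter by
the relaxed objective at the feasible set `P`. Conversely, any ordering `L` of a feasible set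
followed by `q` has utility at least `passProb L ≥ ρ` times its relaxed objective
(`passProb_mul_le_recUtility`). The loop keeps the best `q`, so the factors `ρ`, `1 - ρ` and `α`
multiply. The inequalities on lists are inductions in which answering `q` replaces `g` by `g (insert
q ·)`. This function need not vanish at `∅`, so the submodular estimates subtract `g ∅`. -/

theorem contProb_nonneg (M : CascadeModel Ω) (q : Ω) : 0 ≤ M.contProb q :=
  add_nonneg (mul_nonneg (M.pAns_nonneg q) (M.cAns_nonneg q))
    (mul_nonneg (M.pPna_nonneg q) (M.cPna_nonneg q))

theorem contProb_le_one (M : CascadeModel Ω) (q : Ω) : M.contProb q ≤ 1 := by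
  have h1 := mul_le_of_le_one_right (M.pAns_nonneg q) (M.cAns_le_one q)
  have h2 := mul_le_of_le_one_right (M.pPna_nonneg q) (M.cPna_le_one q)
  have h3 := M.pAns_add_pPna_le_one q
  unfold contProb
  linarith

/-- The probability that a customer who reads the first question of `Q` passes all of `Q`. -/
noncomputable def passProb (M : CascadeModel Ω) (Q : List Ω) : ℝ := (Q.map M.contProb).prod

theorem passProb_cons (M : CascadeModel Ω) (q : Ω) (Q : List Ω) :
    M.passProb (q :: Q) = M.contProb q * M.passProb Q := by
  simp [passProb]

theorem passProb_nonneg (M : CascadeModel Ω) (Q : List Ω) : 0 ≤ M.passProb Q := by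
  induction Q with
  | nil => simp [passProb]
  | cons q Q ih => rw [passProb_cons]; exact mul_nonneg (M.contProb_nonneg q) ih

theorem passProb_le_one (M : CascadeModel Ω) (Q : List Ω) : M.passProb Q ≤ 1 := by
  induction Q with
  | nil => simp [passProb]
  | cons q Q ih =>
    rw [passProb_cons]
    exact mul_le_one₀ (M.contProb_le_one q) (M.passProb_nonneg Q) ih

variable [DecidableEq Ω]

/-- The expected utility of a sequence, computed by conditioning on the action taken at its first
question. -/
noncomputable def recUtility (M : CascadeModel Ω) : (Finset Ω → ℝ) → List Ω → ℝ
  | g, [] => g ∅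
  | g, q :: Q =>
      M.pAns q * M.cAns q * recUtility M (fun S => g (insert q S)) Q +
      M.pAns q * (1 - M.cAns q) * g {q} +
      M.pPna q * M.cPna q * recUtility M g Q +
      (1 - M.pAns q - M.pPna q * M.cPna q) * g ∅

/-- The expected utility of the random subset of a sequence that contains each `q` independently
with probability `pAns q`, computed by conditioning on the first element. -/
noncomputable def recRandomUtility (M : CascadeModel Ω) : (Finset Ω → ℝ) → List Ω → ℝ
  | g, [] => g ∅
  | g, q :: Q =>
      M.pAns q * recRandomUtility M (fun S => g (insert q S)) Q +
      (1 - M.pAns q) * recRandomUtility M g Q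

/-! ### From the browse process to the recursions -/

section Expectation

variable [Fintype Ω]

/-- The expectation of `g` under a law on the subsets of `Ω`. -/
noncomputable def expectation (P : PMF (Finset Ω)) (g : Finset Ω → ℝ) : ℝ :=
  ∑ S, (P S).toReal * g S

theorem expectation_pure (A : Finset Ω) (g : Finset Ω → ℝ) :
    expectation (PMF.pure A) g = g A := by
  simp [expectation, PMF.pure_apply, apply_ite ENNReal.toReal]

theorem expectation_map (P : PMF (Finset Ω)) (φ : Finset Ω → Finset Ω) (g : Finset Ω → ℝ) :
    expectation (P.map φ) g = expectation P (fun S => g (φ S)) := by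
  have h : ∀ S, ((P.map φ) S).toReal = ∑ T, if S = φ T then (P T).toReal else 0 := by
    intro S
    rw [PMF.map_apply, tsum_fintype, ENNReal.toReal_sum]
    · exact Finset.sum_congr rfl fun T _ => by split_ifs <;> simp
    · intro T _
      split_ifs
      · exact P.apply_ne_top T
      · simp
  simp only [expectation, h, Finset.sum_mul]
  rw [Finset.sum_comm]
  simp [ite_mul]

omit [DecidableEq Ω] in
theorem expectation_actionLaw_bind (M : CascadeModel Ω) (q : Ω)
    (P : BrowseAction → PMF (Finset Ω)) (g : Finset Ω → ℝ) :
    expectation ((M.actionLaw q).bind P) g =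
      ∑ a ∈ allActions, M.actionProb q a * expectation (P a) g := by
  have h : ∀ S, (((M.actionLaw q).bind P) S).toReal =
      ∑ a ∈ allActions, M.actionProb q a * (P a S).toReal := by
    intro S
    rw [PMF.bind_apply, tsum_eq_sum (s := allActions), ENNReal.toReal_sum]
    · refine Finset.sum_congr rfl fun a _ => ?_
      rw [ENNReal.toReal_mul]
      congr 1
      exact ENNReal.toReal_ofReal (M.actionProb_nonneg q a)
    · intro a _
      exact ENNReal.mul_ne_top ((M.actionLaw q).apply_ne_top a) ((P a).apply_ne_top S)
    · intro a ha
      exact absurd (by cases a <;> simp [allActions]) ha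
  simp only [expectation, h, Finset.sum_mul, Finset.mul_sum]
  rw [Finset.sum_comm]
  simp only [mul_assoc]

theorem expectation_answeredLaw (M : CascadeModel Ω) (Q : List Ω) (g : Finset Ω → ℝ) :
    expectation (M.answeredLaw Q) g = M.recUtility g Q := by
  induction Q generalizing g with
  | nil => simp [answeredLaw, recUtility, expectation_pure]
  | cons q Q ih =>
    rw [answeredLaw, expectation_actionLaw_bind]
    simp [allActions, Finset.sum, actionProb, expectation_map, expectation_pure, ih, recUtility]
    ring

end Expectation

theorem subset_of_mem_support_answeredLaw (M : CascadeModel Ω) (Q : List Ω) :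
    ∀ S ∈ (M.answeredLaw Q).support, S ⊆ Q.toFinset := by
  induction Q with
  | nil => simp [answeredLaw]
  | cons q Q ih =>
    intro S hS
    rw [answeredLaw, PMF.mem_support_bind_iff] at hS
    obtain ⟨a, -, hS⟩ := hS
    rw [List.toFinset_cons]
    cases a with
    | answerContinue =>
      obtain ⟨T, hT, rfl⟩ := (PMF.mem_support_map_iff _ _ _).1 hS
      exact Finset.insert_subset_insert q (ih T hT)
    | answerExit =>
      obtain rfl : S = {q} := by simpa using hS
      simp
    | pnaContinue => exact (ih S hS).trans (Finset.subset_insert _ _)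
    | pnaExit =>
      obtain rfl : S = ∅ := by simpa using hS
      simp
    | leave =>
      obtain rfl : S = ∅ := by simpa using hS
      simp

/-- Only sets of shown questions have positive probability, so the sum over subsets of `Q` is a full
expectation. -/
theorem expectedUtility_eq_recUtility [Fintype Ω] (M : CascadeModel Ω) (g : Finset Ω → ℝ)
    (Q : List Ω) : M.expectedUtility g Q = M.recUtility g Q := by
  rw [← expectation_answeredLaw, expectedUtility, expectation]
  refine Finset.sum_subset (Finset.subset_univ _) fun S _ hS => ?_
  have h : M.answeredLaw Q S = 0 := by
    by_contra h
    exact hS (Finset.mem_powerset.2 (M.subset_of_mem_support_answeredLaw Q S h))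
  simp [h]

theorem expectedRandomUtility_insert (M : CascadeModel Ω) (g : Finset Ω → ℝ) {q : Ω}
    {S : Finset Ω} (hq : q ∉ S) :
    M.expectedRandomUtility g (insert q S) =
      M.pAns q * M.expectedRandomUtility (fun T => g (insert q T)) S +
      (1 - M.pAns q) * M.expectedRandomUtility g S := by
  unfold expectedRandomUtility
  rw [Finset.sum_powerset_insert hq, add_comm, Finset.mul_sum, Finset.mul_sum]
  congr 1
  · refine Finset.sum_congr rfl fun T hT => ?_
    have hqT : q ∉ T := fun h => hq (Finset.mem_powerset.1 hT h)
    rw [Finset.prod_insert hqT, Finset.insert_sdiff_insert, Finset.sdiff_insert_of_notMem hq]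
    ring
  · refine Finset.sum_congr rfl fun T hT => ?_
    have hqT : q ∉ T := fun h => hq (Finset.mem_powerset.1 hT h)
    rw [Finset.insert_sdiff_of_notMem _ hqT, Finset.prod_insert (by simp [hq])]
    ring

theorem expectedRandomUtility_toFinset (M : CascadeModel Ω) (g : Finset Ω → ℝ) {Q : List Ω}
    (hQ : Q.Nodup) : M.expectedRandomUtility g Q.toFinset = M.recRandomUtility g Q := by
  induction Q generalizing g with
  | nil => simp [expectedRandomUtility, recRandomUtility]
  | cons q Q ih =>
    obtain ⟨hq, hQ⟩ := List.nodup_cons.1 hQ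
    rw [List.toFinset_cons, M.expectedRandomUtility_insert g (by simpa using hq), ih _ hQ,
      ih _ hQ, recRandomUtility]

theorem recRandomUtility_mono (M : CascadeModel Ω) (Q : List Ω) {g h : Finset Ω → ℝ}
    (hgh : ∀ S, g S ≤ h S) : M.recRandomUtility g Q ≤ M.recRandomUtility h Q := by
  induction Q generalizing g h with
  | nil => exact hgh ∅
  | cons q Q ih =>
    have h1 := mul_le_mul_of_nonneg_left (ih fun S => hgh (insert q S)) (M.pAns_nonneg q)
    have h2 : 0 ≤ 1 - M.pAns q := by
      linarith [M.pAns_add_pPna_le_one q, M.pPna_nonneg q]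
    have h3 := mul_le_mul_of_nonneg_left (ih hgh) h2
    simp only [recRandomUtility]
    linarith

theorem recRandomUtility_add_const (M : CascadeModel Ω) (Q : List Ω) (g : Finset Ω → ℝ) (r : ℝ) :
    M.recRandomUtility (fun S => g S + r) Q = M.recRandomUtility g Q + r := by
  induction Q generalizing g with
  | nil => rfl
  | cons q Q ih => simp only [recRandomUtility, ih]; ring

theorem le_recRandomUtility (M : CascadeModel Ω) (Q : List Ω) {g : Finset Ω → ℝ}
    (hg : Monotone g) : g ∅ ≤ M.recRandomUtility g Q := by
  have h0 : M.recRandomUtility (fun _ => 0) Q = 0 := by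
    induction Q with
    | nil => rfl
    | cons q Q ih => simp only [recRandomUtility, ih]; ring
  have h1 := M.recRandomUtility_add_const Q (fun _ => 0) (g ∅)
  rw [h0] at h1
  have h2 := M.recRandomUtility_mono Q (g := fun _ => 0 + g ∅) (h := g)
    fun S => by simpa using hg (Finset.empty_subset S)
  linarith

theorem recUtility_mono (M : CascadeModel Ω) (Q : List Ω) {g h : Finset Ω → ℝ}
    (hgh : ∀ S, g S ≤ h S) : M.recUtility g Q ≤ M.recUtility h Q := by
  induction Q generalizing g h with
  | nil => exact hgh ∅
  | cons q Q ih =>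
    have h1 := mul_le_mul_of_nonneg_left (ih fun S => hgh (insert q S))
      (mul_nonneg (M.pAns_nonneg q) (M.cAns_nonneg q))
    have h2 := mul_le_mul_of_nonneg_left (hgh {q})
      (mul_nonneg (M.pAns_nonneg q) (sub_nonneg.2 (M.cAns_le_one q)))
    have h3 := mul_le_mul_of_nonneg_left (ih hgh)
      (mul_nonneg (M.pPna_nonneg q) (M.cPna_nonneg q))
    have h4 : 0 ≤ 1 - M.pAns q - M.pPna q * M.cPna q := by
      linarith [M.pAns_add_pPna_le_one q,
        mul_le_of_le_one_right (M.pPna_nonneg q) (M.cPna_le_one q)]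
    have h5 := mul_le_mul_of_nonneg_left (hgh ∅) h4
    simp only [recUtility]
    linarith

theorem recUtility_add_const (M : CascadeModel Ω) (Q : List Ω) (g : Finset Ω → ℝ) (r : ℝ) :
    M.recUtility (fun S => g S + r) Q = M.recUtility g Q + r := by
  induction Q generalizing g with
  | nil => rfl
  | cons q Q ih => simp only [recUtility, ih]; ring

end CascadeModel

/-! ### Submodular marginals -/

section Submodular

variable {Ω : Type*} [DecidableEq Ω]

theorem Monotone.comp_finset_insert {g : Finset Ω → ℝ} (hg : Monotone g) (q : Ω) :
    Monotone fun S => g (insert q S) :=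
  fun _ _ h => hg (Finset.insert_subset_insert q h)

theorem IsSubmodular.comp_finset_insert {g : Finset Ω → ℝ} (hs : IsSubmodular g) (q : Ω) : IsSubmodular fun S => g (insert q S) := by
  intro Y₁ Y₂ hY y hy
  rcases eq_or_ne y q with rfl | hyq
  · simp
  · have := hs (insert q Y₁) (insert q Y₂) (Finset.insert_subset_insert q hY) y
      (by simp [hyq, hy])
    simpa only [Finset.insert_comm q y] using this

theorem IsSubmodular.insert_le {g : Finset Ω → ℝ} (hg : Monotone g) (hs : IsSubmodular g)
    (q : Ω) (S : Finset Ω) : g (insert q S) ≤ g S + (g {q} - g ∅) := by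
  by_cases hq : q ∈ S
  · rw [Finset.insert_eq_of_mem hq]
    linarith [hg (Finset.empty_subset {q})]
  · have h := hs ∅ S (Finset.empty_subset S) q hq
    simp only [insert_empty_eq] at h
    linarith

end Submodular

/-! ### Comparison of the cascade with independent answers -/

namespace CascadeModel

variable {Ω : Type*} [DecidableEq Ω]

/-- Exiting only discards later answers, which cannot help a monotone `g`. -/
theorem recUtility_le_recRandomUtility (M : CascadeModel Ω) (Q : List Ω) {g : Finset Ω → ℝ}
    (hg : Monotone g) : M.recUtility g Q ≤ M.recRandomUtility g Q := by
  induction Q generalizing g with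
  | nil => exact le_rfl
  | cons q Q ih =>
    have hg' := hg.comp_finset_insert q
    have h1 := mul_le_mul_of_nonneg_left (ih hg')
      (mul_nonneg (M.pAns_nonneg q) (M.cAns_nonneg q))
    have h2 := mul_le_mul_of_nonneg_left (M.le_recRandomUtility Q hg')
      (mul_nonneg (M.pAns_nonneg q) (sub_nonneg.2 (M.cAns_le_one q)))
    have h3 := mul_le_mul_of_nonneg_left (ih hg)
      (mul_nonneg (M.pPna_nonneg q) (M.cPna_nonneg q))
    have h4 : 0 ≤ 1 - M.pAns q - M.pPna q * M.cPna q := by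
      linarith [M.pAns_add_pPna_le_one q,
        mul_le_of_le_one_right (M.pPna_nonneg q) (M.cPna_le_one q)]
    have h5 := mul_le_mul_of_nonneg_left (M.le_recRandomUtility Q hg) h4
    simp only [insert_empty_eq] at h2
    simp only [recUtility, recRandomUtility]
    linarith

/-- `R` is reached with probability `passProb P`, and its gain on top of earlier answers is at most
its gain from `∅`. -/
theorem recUtility_append_le (M : CascadeModel Ω) (P R : List Ω) {g : Finset Ω → ℝ}
    (hg : Monotone g) (hs : IsSubmodular g) :
    M.recUtility g (P ++ R) ≤
      M.recUtility g P + M.passProb P * (M.recUtility g R - g ∅) := by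
  induction P generalizing g with
  | nil => simp [recUtility, passProb]
  | cons q P ih =>
    have hac := mul_nonneg (M.pAns_nonneg q) (M.cAns_nonneg q)
    have h1 := mul_le_mul_of_nonneg_left
      (ih (hg.comp_finset_insert q) (hs.comp_finset_insert q)) hac
    have h2 := mul_le_mul_of_nonneg_left (ih hg hs)
      (mul_nonneg (M.pPna_nonneg q) (M.cPna_nonneg q))
    have h3 := M.recUtility_mono R (hs.insert_le hg q)
    rw [recUtility_add_const] at h3
    have h4 : M.recUtility (fun S => g (insert q S)) R - g {q} ≤ M.recUtility g R - g ∅ := by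
      linarith
    have h5 := mul_le_mul_of_nonneg_left h4 (mul_nonneg hac (M.passProb_nonneg P))
    simp only [insert_empty_eq] at h1
    simp only [List.cons_append, recUtility, passProb_cons, contProb]
    linarith

/-- Conditioning on passing `P` can bias the answers, since continuing depends on the action.
Submodularity compensates: `q` is answered with probability `pAns q` whether or not she continues,
and its gain over `∅` dominates its gain over later answers. The last question need only be read, so
`x` is absent from `passProb`. -/
theorem passProb_mul_le_recUtility (M : CascadeModel Ω) (P : List Ω) (x : Ω) {g : Finset Ω → ℝ}
    (hg : Monotone g) (hs : IsSubmodular g) :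
    M.passProb P * (M.recRandomUtility g (P ++ [x]) - g ∅) ≤
      M.recUtility g (P ++ [x]) - g ∅ := by
  induction P generalizing g with
  | nil => simp [recUtility, recRandomUtility, passProb]; linarith
  | cons q P ih =>
    have ha := mul_nonneg (M.pAns_nonneg q) (M.cAns_nonneg q)
    have hd := mul_nonneg (M.pPna_nonneg q) (M.cPna_nonneg q)
    have hap := mul_le_of_le_one_right (M.pAns_nonneg q) (M.cAns_le_one q)
    have h1 := mul_le_mul_of_nonneg_left
      (ih (hg.comp_finset_insert q) (hs.comp_finset_insert q)) ha
    have h2 := mul_le_mul_of_nonneg_left (ih hg hs) hd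
    have hc1 := M.contProb_le_one q
    have hr1 := M.passProb_le_one P
    have hp := M.pAns_nonneg q
    have ht := M.recRandomUtility_mono (P ++ [x]) (hs.insert_le hg q)
    rw [recRandomUtility_add_const] at ht
    have hH := M.recRandomUtility_mono (P ++ [x])
      (fun S => hg (Finset.subset_insert q S) : ∀ S, g S ≤ g (insert q S))
    simp only [insert_empty_eq] at h1
    simp only [List.cons_append, recUtility, recRandomUtility, passProb_cons]
    unfold contProb at hc1 ⊢
    rw [mul_one_sub]
    generalize M.recRandomUtility (fun S => g (insert q S)) (P ++ [x]) = X at *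
    generalize M.recRandomUtility g (P ++ [x]) = Y at *
    generalize M.recUtility (fun S => g (insert q S)) (P ++ [x]) = U at *
    generalize M.recUtility g (P ++ [x]) = W at *
    generalize M.pPna q * M.cPna q = d at *
    generalize M.pAns q * M.cAns q = a at *
    generalize M.passProb P = r at *
    generalize M.pAns q = p at *
    generalize g {q} = G at *
    generalize g ∅ = E at *
    have hc0 : 0 ≤ a + d := add_nonneg ha hd
    have hrc : r * (a + d) ≤ 1 := mul_le_one₀ hr1 hc0 hc1
    have hX : 0 ≤ X - Y := sub_nonneg.2 hH
    have hY : 0 ≤ Y + (G - E) - X := sub_nonneg.2 ht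
    have hra : r * a ≤ p := (mul_le_of_le_one_left ha hr1).trans hap
    -- After `h1` and `h2`, the remaining gap is exactly `p (X - Y) (1 - r (a + d)) + (p - r a) (G -
    -- E - (X - Y))`.
    have k1 := mul_nonneg hX (mul_nonneg hp (sub_nonneg.2 hrc))
    have k2 := mul_nonneg hY (sub_nonneg.2 hra)
    linarith only [h1, h2, k1, k2]

omit [DecidableEq Ω] in
theorem exists_split (M : CascadeModel Ω) {ρ : ℝ} (hρ : ρ ≤ 1) {Q : List Ω} (hQ : Q ≠ []) :
    ∃ P x R, Q = P ++ x :: R ∧ ρ ≤ M.passProb P ∧ (R = [] ∨ M.passProb (P ++ [x]) ≤ ρ) := by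
  induction Q using List.reverseRecOn with
  | nil => exact absurd rfl hQ
  | append_singleton Q y ih =>
    rcases eq_or_ne Q [] with rfl | hne
    · exact ⟨[], y, [], rfl, by simpa [passProb] using hρ, Or.inl rfl⟩
    · obtain ⟨P, x, R, rfl, hP, hR⟩ := ih hne
      by_cases h : M.passProb (P ++ [x]) ≤ ρ
      · exact ⟨P, x, R ++ [y], by simp, hP, Or.inr h⟩
      · obtain rfl : R = [] := hR.resolve_right h
        exact ⟨P ++ [x], y, [], rfl, (not_le.1 h).le, Or.inl rfl⟩


/-! ### The relaxed problem and the algorithm -/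

theorem sum_log_contProb (M : CascadeModel Ω) (S : Finset Ω) :
    ∑ l ∈ S, ENNReal.log (ENNReal.ofReal (M.contProb l)) =
      ENNReal.log (ENNReal.ofReal (∏ l ∈ S, M.contProb l)) := by
  induction S using Finset.induction_on with
  | empty => simp
  | insert q S hq ih =>
    rw [Finset.sum_insert hq, Finset.prod_insert hq, ih,
      ENNReal.ofReal_mul (M.contProb_nonneg q), ENNReal.log_mul_add]

theorem passProb_eq_prod (M : CascadeModel Ω) {Q : List Ω} (hQ : Q.Nodup) :
    M.passProb Q = ∏ l ∈ Q.toFinset, M.contProb l :=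
  (List.prod_toFinset _ hQ).symm

theorem relaxedFeasible_iff (M : CascadeModel Ω) (ρ : ℝ) (b : ℕ) (q : Ω) (S : Finset Ω) :
    M.RelaxedFeasible ρ b q S ↔ ρ ≤ ∏ l ∈ S, M.contProb l ∧ S.card < b ∧ q ∉ S := by
  have h : -∑ l ∈ S, ENNReal.log (ENNReal.ofReal (M.contProb l)) ≤
      -ENNReal.log (ENNReal.ofReal ρ) ↔ ρ ≤ ∏ l ∈ S, M.contProb l := by
    rw [EReal.neg_le_neg_iff, sum_log_contProb, ENNReal.log_le_log_iff,
      ENNReal.ofReal_le_ofReal_iff (Finset.prod_nonneg fun l _ => M.contProb_nonneg l)]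
  exact ⟨fun ⟨h1, h2, h3⟩ => ⟨h.1 h1, h2, h3⟩, fun ⟨h1, h2, h3⟩ => ⟨h.2 h1, h2, h3⟩⟩

theorem relaxedObjective_toFinset (M : CascadeModel Ω) (g : Finset Ω → ℝ) {P : List Ω} {x : Ω}
    (h : (P ++ [x]).Nodup) :
    M.relaxedObjective g (some x) P.toFinset = M.recRandomUtility g (P ++ [x]) := by
  rw [relaxedObjective, ← M.expectedRandomUtility_toFinset g h]
  simp

theorem relaxedObjective_nonneg (M : CascadeModel Ω) {g : Finset Ω → ℝ} (hg0 : g ∅ = 0)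
    (hg : Monotone g) (q : Option Ω) (S : Finset Ω) : 0 ≤ M.relaxedObjective g q S := by
  have h := M.le_recRandomUtility (S ∪ q.toFinset).toList hg
  rw [← M.expectedRandomUtility_toFinset g (Finset.nodup_toList _), Finset.toList_toFinset,
    hg0] at h
  exact h

/-- A subset of maximal objective value is an approximate solution for every ratio at most one. -/
theorem exists_relaxedApprox [Fintype Ω] (M : CascadeModel Ω) {g : Finset Ω → ℝ}
    (hg0 : g ∅ = 0) (hg : Monotone g) {ρ : ℝ} (hρ : ρ ≤ 1) {b : ℕ} (hb : 0 < b) {α : ℝ}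
    (hα : α ≤ 1) (q : Ω) : ∃ S, M.RelaxedApprox g ρ b α q S := by
  classical
  obtain ⟨S, hS, hmax⟩ := Finset.exists_max_image
    (Finset.univ.filter fun S => M.RelaxedFeasible ρ b q S) (M.relaxedObjective g (some q))
    ⟨∅, by simp [relaxedFeasible_iff, hρ, hb]⟩
  refine ⟨S, (Finset.mem_filter.1 hS).2, fun T hT => ?_⟩
  have h0 := M.relaxedObjective_nonneg hg0 hg (some q) T
  exact (mul_le_of_le_one_left h0 hα).trans (hmax T (by simpa using hT))

/-- The running maximum never decreases, and the stored set is always the one solved for the stored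
question. -/
theorem algLoop_spec (M : CascadeModel Ω) (g : Finset Ω → ℝ) (solve : Ω → Finset Ω)
    (order : List Ω) :
    (∀ q ∈ order, M.relaxedObjective g (some q) (solve q) ≤
      M.relaxedObjective g (M.algLoop g solve order).1 (M.algLoop g solve order).2) ∧
    (M.algLoop g solve order = (none, ∅) ∨
      ∃ q, M.algLoop g solve order = (some q, solve q)) := by
  induction order using List.reverseRecOn with
  | nil => simp [algLoop]
  | append_singleton order y ih =>
    have hstep : M.algLoop g solve (order ++ [y]) =
        if M.relaxedObjective g (some y) (solve y) >
          M.relaxedObjective g (M.algLoop g solve order).1 (M.algLoop g solve order).2 then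
          (some y, solve y) else M.algLoop g solve order := by
      simp [algLoop, List.foldl_append]
    obtain ⟨ih1, ih2⟩ := ih
    rw [hstep]
    split_ifs with h
    · refine ⟨fun q hq => ?_, Or.inr ⟨y, rfl⟩⟩
      rcases List.mem_append.1 hq with hq | hq
      · exact (ih1 q hq).trans h.le
      · rw [List.mem_singleton.1 hq]
    · refine ⟨fun q hq => ?_, ih2⟩
      rcases List.mem_append.1 hq with hq | hq
      · exact ih1 q hq
      · rw [List.mem_singleton.1 hq]
        exact not_lt.1 h

theorem exists_isAlgOutput [Fintype Ω] (M : CascadeModel Ω) {g : Finset Ω → ℝ}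
    (hg0 : g ∅ = 0) (hg : Monotone g) {ρ : ℝ} (hρ : ρ ≤ 1) {b : ℕ} (hb : 0 < b) {α : ℝ}
    (hα : α ≤ 1) : ∃ Q, M.IsAlgOutput g ρ b α Q := by
  choose solve hsolve using M.exists_relaxedApprox hg0 hg hρ hb hα
  exact ⟨_, Finset.univ.toList, solve, _, ⟨Finset.nodup_toList _, by simp⟩, hsolve,
    ⟨Finset.nodup_toList _, Finset.toList_toFinset _⟩, rfl⟩

/-- Some relaxed solution attains a fraction `1 - ρ` of the optimum. -/
theorem exists_relaxedFeasible_ge [Fintype Ω] (M : CascadeModel Ω) {g : Finset Ω → ℝ}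
    (hg0 : g ∅ = 0) (hg : Monotone g) (hs : IsSubmodular g) {ρ : ℝ} (hρ0 : 0 ≤ ρ) (hρ : ρ ≤ 1)
    {b : ℕ} {Q : List Ω} (hQ : M.IsOptimalSolution g b Q) (hne : Q ≠ []) :
    ∃ q S, M.RelaxedFeasible ρ b q S ∧
      (1 - ρ) * M.expectedUtility g Q ≤ M.relaxedObjective g (some q) S := by
  obtain ⟨⟨hnd, hlen⟩, hopt⟩ := hQ
  obtain ⟨P, x, R, rfl, hP, hR⟩ := M.exists_split hρ hne
  have hsplit : P ++ x :: R = (P ++ [x]) ++ R := by simp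
  rw [hsplit] at hnd hlen hopt ⊢
  obtain ⟨hPx, hRnd, -⟩ := List.nodup_append.1 hnd
  have hxP : x ∉ P := by
    intro h
    exact (List.nodup_append.1 hPx).2.2 x h x (by simp) rfl
  have hPnd : P.Nodup := (List.nodup_append.1 hPx).1
  simp only [List.length_append, List.length_singleton] at hlen
  refine ⟨x, P.toFinset, (M.relaxedFeasible_iff _ _ _ _).2 ⟨?_, ?_, by simpa using hxP⟩, ?_⟩
  · rwa [← M.passProb_eq_prod hPnd]
  · rw [List.toFinset_card_of_nodup hPnd]
    omega
  · rw [M.relaxedObjective_toFinset g hPx]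
    have h1 := M.recUtility_le_recRandomUtility (P ++ [x]) hg
    have h2 := M.recUtility_append_le (P ++ [x]) R hg hs
    -- The tail is itself a solution, so optimality bounds its utility.
    have h3 := hopt R ⟨hRnd, by omega⟩
    have h0 := hopt [] ⟨List.nodup_nil, Nat.zero_le b⟩
    simp only [expectedUtility_eq_recUtility] at h3 h0 ⊢
    have h0' : M.recUtility g [] = 0 := hg0
    rw [h0'] at h0
    rw [hg0, sub_zero] at h2
    have h4 : M.passProb (P ++ [x]) * M.recUtility g R ≤
        ρ * M.recUtility g (P ++ [x] ++ R) := by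
      rcases hR with rfl | hR
      · rw [h0', mul_zero]
        exact mul_nonneg hρ0 h0
      · exact (mul_le_mul_of_nonneg_left h3 (M.passProb_nonneg _)).trans
          (mul_le_mul_of_nonneg_right hR h0)
    linarith

/-- Arranging a relaxed solution in any order loses at most a factor `ρ`. -/
theorem le_expectedUtility_of_relaxedFeasible [Fintype Ω] (M : CascadeModel Ω)
    {g : Finset Ω → ℝ} (hg0 : g ∅ = 0) (hg : Monotone g) (hs : IsSubmodular g) {ρ : ℝ} {b : ℕ}
    {q : Ω} {L : List Ω} (hL : L.Nodup) (h : M.RelaxedFeasible ρ b q L.toFinset) :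
    IsSolution b (L ++ [q]) ∧
      ρ * M.relaxedObjective g (some q) L.toFinset ≤ M.expectedUtility g (L ++ [q]) := by
  have h0 := M.relaxedObjective_nonneg hg0 hg (some q) L.toFinset
  obtain ⟨hρ, hcard, hq⟩ := (M.relaxedFeasible_iff _ _ _ _).1 h
  rw [← M.passProb_eq_prod hL] at hρ
  rw [List.toFinset_card_of_nodup hL] at hcard
  have hnd : (L ++ [q]).Nodup := by
    rw [← List.concat_eq_append]
    exact hL.concat (by simpa using hq)
  refine ⟨⟨hnd, by simpa using hcard⟩, ?_⟩
  have h1 := M.passProb_mul_le_recUtility L q hg hs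
  rw [hg0, sub_zero, sub_zero, ← M.relaxedObjective_toFinset g hnd] at h1
  rw [expectedUtility_eq_recUtility]
  exact (mul_le_mul_of_nonneg_right hρ h0).trans h1

theorem IsAlgOutput.spec [Fintype Ω] {M : CascadeModel Ω} {g : Finset Ω → ℝ} (hg0 : g ∅ = 0)
    (hg : Monotone g) (hs : IsSubmodular g) {ρ : ℝ} (hρ0 : 0 ≤ ρ) {b : ℕ} {α : ℝ} {Q : List Ω}
    (hQ : M.IsAlgOutput g ρ b α Q) :
    IsSolution b Q ∧ 0 ≤ M.expectedUtility g Q ∧ ∀ q T, M.RelaxedFeasible ρ b q T →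
      ρ * (α * M.relaxedObjective g (some q) T) ≤ M.expectedUtility g Q := by
  obtain ⟨order, solve, L, ⟨-, hall⟩, hsolve, ⟨hL, hLS⟩, rfl⟩ := hQ
  obtain ⟨hmax, hst⟩ := M.algLoop_spec g solve order
  have hout : IsSolution b (L ++ (M.algLoop g solve order).1.toList) ∧
      ρ * M.relaxedObjective g (M.algLoop g solve order).1 (M.algLoop g solve order).2 ≤
        M.expectedUtility g (L ++ (M.algLoop g solve order).1.toList) := by
    rcases hst with hst | ⟨q, hst⟩
    -- No update occurred: the output is empty and both sides are zero.
    · rw [hst] at hLS ⊢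
      obtain rfl : L = [] := by simpa using hLS
      have h : M.recUtility g [] = 0 := hg0
      simp [IsSolution, expectedUtility_eq_recUtility, h, relaxedObjective,
        expectedRandomUtility, hg0]
    · rw [hst] at hLS ⊢
      replace hLS : L.toFinset = solve q := hLS
      have h := M.le_expectedUtility_of_relaxedFeasible hg0 hg hs hL (hLS.symm ▸ (hsolve q).1 :
        M.RelaxedFeasible ρ b q L.toFinset)
      rw [hLS] at h
      exact h
  refine ⟨hout.1, (mul_nonneg hρ0 (M.relaxedObjective_nonneg hg0 hg _ _)).trans hout.2,
    fun q T hT => ?_⟩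
  exact (mul_le_mul_of_nonneg_left (((hsolve q).2 T hT).trans (hmax q (hall q))) hρ0).trans hout.2

theorem IsAlgOutput.approx [Fintype Ω] {M : CascadeModel Ω} {g : Finset Ω → ℝ} (hg0 : g ∅ = 0)
    (hg : Monotone g) (hs : IsSubmodular g) {ρ : ℝ} (hρ0 : 0 ≤ ρ) (hρ : ρ ≤ 1) {b : ℕ} {α : ℝ}
    {Q Qstar : List Ω} (hQ : M.IsAlgOutput g ρ b α Q) (hstar : M.IsOptimalSolution g b Qstar) :
    ρ * (1 - ρ) * α * M.expectedUtility g Qstar ≤ M.expectedUtility g Q := by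
  obtain ⟨hsol, hnonneg, hle⟩ := hQ.spec hg0 hg hs hρ0
  have hopt : 0 ≤ M.expectedUtility g Qstar := hnonneg.trans (hstar.2 Q hsol)
  -- A large `ε` makes the ratio negative; the claim then follows from nonnegative utilities.
  rcases le_total α 0 with hα | hα
  · refine le_trans ?_ hnonneg
    exact mul_nonpos_of_nonpos_of_nonneg
      (mul_nonpos_of_nonneg_of_nonpos (mul_nonneg hρ0 (sub_nonneg.2 hρ)) hα) hopt
  · rcases eq_or_ne Qstar [] with rfl | hne
    · have h : M.recUtility g [] = 0 := hg0
      rw [expectedUtility_eq_recUtility, h, mul_zero]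
      exact hnonneg
    · obtain ⟨q, S, hS, hge⟩ := M.exists_relaxedFeasible_ge hg0 hg hs hρ0 hρ hstar hne
      calc ρ * (1 - ρ) * α * M.expectedUtility g Qstar
          = ρ * (α * ((1 - ρ) * M.expectedUtility g Qstar)) := by ring
        _ ≤ ρ * (α * M.relaxedObjective g (some q) S) := by gcongr
        _ ≤ M.expectedUtility g Q := hle q S hS

end CascadeModel

theorem mainTheorem1 {Ω : Type*} [Fintype Ω] [DecidableEq Ω] (M : CascadeModel Ω)
    (g : Finset Ω → ℝ) (hg_empty : g ∅ = 0) (hg_mono : Monotone g) (hg_sub : IsSubmodular g)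
    (b : ℕ) (hb : 0 < b) (ε : ℝ) (hε : 0 < ε) :
    (∀ ρ : ℝ, 0 ≤ ρ → ρ ≤ 1 →
      (∃ Q, M.IsAlgOutput g ρ b (1 - 1 / Real.exp 1 - ε) Q) ∧
      ∀ Q, M.IsAlgOutput g ρ b (1 - 1 / Real.exp 1 - ε) Q →
        CascadeModel.IsSolution b Q ∧
        ∀ Qstar, M.IsOptimalSolution g b Qstar →
          M.expectedUtility g Q ≥
            ρ * (1 - ρ) * (1 - 1 / Real.exp 1 - ε) * M.expectedUtility g Qstar) ∧
    (∀ Q, M.IsAlgOutput g (1 / 2) b (1 - 1 / Real.exp 1 - ε) Q →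
      ∀ Qstar, M.IsOptimalSolution g b Qstar →
        M.expectedUtility g Q ≥
          (1 / 4) * (1 - 1 / Real.exp 1 - ε) * M.expectedUtility g Qstar) := by
  have hα : 1 - 1 / Real.exp 1 - ε ≤ 1 := by
    have : 0 < 1 / Real.exp 1 := by positivity
    linarith
  refine ⟨fun ρ hρ0 hρ => ⟨M.exists_isAlgOutput hg_empty hg_mono hρ hb hα, fun Q hQ =>
    ⟨(hQ.spec hg_empty hg_mono hg_sub hρ0).1, fun Qstar hstar =>
      hQ.approx hg_empty hg_mono hg_sub hρ0 hρ hstar⟩⟩, fun Q hQ Qstar hstar => ?_⟩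
  have h := hQ.approx hg_empty hg_mono hg_sub (by norm_num) (by norm_num) hstar
  norm_num at h ⊢
  exact h
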